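/- **Setting.** Let $Q$ be a finite-dimensional smooth manifold, $G$ a Lie group with Lie algebra $\mathfrak g$ acting smoothly on $Q$ on the left so that $\pi:Q\to Q/G$ is a (smooth, locally trivial) principal $G$-bundle. Write $\xi_Q$ for the infinitesimal generator of $\xi\in\mathfrak g$. * A *forced discrete mechanical system* $(Q,L_d,f_d)$ consists of a smooth function $L_d:Q\times Q\to\mathbb R$ and a smooth $1$-form $f_d$ on $Q\times Q$. $G$ is a *symmetry group* of it if $L_d$ and $f_d$ are invariant under the diagonal action of $G$ on $Q\times Q$. A discrete curve $q_\cdot=(q_0,\dots,q_N)$ in $Q$ is a *trajectory* if $$\delta\Big(\sum_{k=0}^{N-1}L_d(q_k,q_{k+1})\Big)+\sum_{k=0}^{N-1}f_d(q_k,q_{k+1})(\delta q_k,\delta q_{k+1})=0$$ for all $\delta q_k\in T_{q_k}Q$ ($0\le k\le N$) with $\delta q_0=0$ and $\delta q_N=0$. * An *affine discrete connection* of level $\gamma$, where $\gamma:Q\to G$ is smooth with $\gamma(gq)=g\gamma(q)g^{-1}$, is a smooth map $\mathcal A_d:Q\times Q\to G$ with $\mathcal A_d(g_0q_0,g_1q_1)=g_1\mathcal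 A_d(q_0,q_1)g_0^{-1}$ and $\mathcal A_d(q,\gamma(q)q)=e$. A *principal connection* is a smooth $\mathfrak g$-valued $1$-form $\mathfrak A$ on $Q$ with $\mathfrak A(\xi_Q(q))=\xi$ and $\mathfrak A(Tl_g(v))=\operatorname{Ad}_g\mathfrak A(v)$, where $l_g(q)=gq$; for $u\in T_{\pi(q)}(Q/G)$, $h^q(u)\in T_qQ$ is the vector with $\mathfrak A(h^q(u))=0$ and $T\pi(h^q(u))=u$. * $\tilde G:=(Q\times G)/G$ for the action $g\cdot(q,w)=(gq,gwg^{-1})$, with quotient map $\rho:Q\times G\to\tilde G$ and projection $\operatorname{pr}^{Q/G}:\tilde G\to Q/G$, $\rho(q,w)\mapsto\pi(q)$. Put $\Upsilon(q_0,q_1):=(\rho(q_0,\mathcal A_d(q_0,q_1)),\pi(q_1))\in\tilde G\times Q/G$. The map $\tilde\Phi(q_0,q_1):=(q_0,\mathcal A_d(q_0,q_1),\pi(q_1))$ is a bijection $Q\times Q\to Q\times G\times Q/G$; let $\tilde\Psi$ be its inverse, $\check L_d:=L_d\circ\tilde\Psi$ and $\check f_d:=\tilde\Psi^*f_d=\check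 f_d^1+\check f_d^2+\check f_d^3$ (components along $Q$, $G$, $Q/G$). $D_i$ denotes the partial differential in the $i$-th variable. **Reduced equations.** A discrete curve $(v_\cdot,\tau_\cdot)=((v_0,\tau_1),\dots,(v_{N-1},\tau_N))$ in $\tilde G\times Q/G$ *satisfies the reduced equations* if for each $1\le k\le N-1$ and for some (equivalently, every) $q_{k-1},q_k,q_{k+1}\in Q$ with $\Upsilon(q_{k-1},q_k)=(v_{k-1},\tau_k)$ and $\Upsilon(q_k,q_{k+1})=(v_k,\tau_{k+1})$, writing $w_j:=\mathcal A_d(q_j,q_{j+1})$, $x_j:=(q_j,w_j,\tau_{j+1})$, one has $\phi=0$ in $T^*_{\tau_k}(Q/G)$ and $\psi=0$ in $\mathfrak g^*$, where $$\begin{aligned}\phi:={}&D_1\check L_d(x_k)\circ h^{q_k}+D_3\check L_d(x_{k-1})+D_2\check L_d(x_k)\,D_1\mathcal A_d(q_k,q_{k+1})\circ h^{q_k}+D_2\check L_d(x_{k-1})\,D_2\mathcal A_d(q_{k-1},q_k)\circ h^{q_k}\\&+\check f_d^1(x_k)\circ h^{q_k}+\check f_d^3(x_{k-1})+\check f_d^2(x_k)\,D_1\mathcal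 A_d(q_k,q_{k+1})\circ h^{q_k}+\check f_d^2(x_{k-1})\,D_2\mathcal A_d(q_{k-1},q_k)\circ h^{q_k},\end{aligned}$$ $$\begin{aligned}\psi(\xi):={}&\big(D_2\check L_d(x_{k-1})w_{k-1}^{-1}-D_2\check L_d(x_k)w_k^{-1}\big)(\xi)\\&+\big(\check f_d^1(x_k)+\check f_d^2(x_k)D_1\mathcal A_d(q_k,q_{k+1})+\check f_d^2(x_{k-1})D_2\mathcal A_d(q_{k-1},q_k)\big)(\xi_Q(q_k)),\end{aligned}$$ and for $\alpha\in T_w^*G$ the covector $\alpha w^{-1}\in\mathfrak g^*$ is the right translate $(\alpha w^{-1})(\xi):=\alpha(T_eR_w\,\xi)$, $R_w(x)=xw$. **Theorem.** Let $\pi:Q\to Q/G$ be a principal $G$-bundle, $\mathcal A_d$ an affine discrete connection and $\mathfrak A$ a principal connection on it, and $(Q,L_d,f_d)$ a forced discrete mechanical system with symmetry group $G$. Let $N\ge1$ and let $(v_\cdot,\tau_\cdot)=((v_0,\tau_1),\dots,(v_{N-1},\tau_N))$ be a discrete curve in $\tilde G\times Q/G$ such that $\tau_k=\operatorname{pr}^{Q/G}(v_k)$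 for all $1\le k\le N-1$. Let $q_0\in Q$ with $\pi(q_0)=\operatorname{pr}^{Q/G}(v_0)$. 1. There exists a unique discrete curve $q_\cdot=(q_0,\dots,q_N)$ in $Q$, starting at the given $q_0$, such that $\Upsilon(q_k,q_{k+1})=(v_k,\tau_{k+1})$ for all $0\le k\le N-1$. 2. If $(v_\cdot,\tau_\cdot)$ satisfies the reduced equations, then the curve $q_\cdot$ of item 1 is a trajectory of $(Q,L_d,f_d)$. -/

import Mathlib

open scoped Manifold ContDiff

set_option linter.unusedSectionVars false

noncomputable section

namespace FDMech

/-! ### Forced discrete mechanical systems -/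

section Systems

variable (E : Type*) [NormedAddCommGroup E] [NormedSpace ℝ E]
  (Q : Type*) [TopologicalSpace Q] [ChartedSpace E Q] [IsManifold 𝓘(ℝ, E) ∞ Q]

/-- A forced discrete mechanical system on the manifold `Q`: a smooth discrete Lagrangian `L` on
`Q × Q` and a discrete force `f`, a smooth `1`-form on `Q × Q` (a smooth section of the cotangent
bundle). -/
structure FDMS where
  L : Q × Q → ℝ
  contMDiff_L : ContMDiff (𝓘(ℝ, E).prod 𝓘(ℝ, E)) 𝓘(ℝ, ℝ) ∞ L
  f : ∀ p : Q × Q, TangentSpace (𝓘(ℝ, E).prod 𝓘(ℝ, E)) p →L[ℝ] ℝ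
  contMDiff_f : ContMDiff (𝓘(ℝ, E).prod 𝓘(ℝ, E))
    ((𝓘(ℝ, E).prod 𝓘(ℝ, E)).prod 𝓘(ℝ, E × E →L[ℝ] ℝ)) ∞
    (fun p : Q × Q ↦ Bundle.TotalSpace.mk' (E × E →L[ℝ] ℝ)
      (E := fun p : Q × Q ↦ TangentSpace (𝓘(ℝ, E).prod 𝓘(ℝ, E)) p →L[ℝ]
        Bundle.Trivial (Q × Q) ℝ p) p (f p))

variable {E Q}

/-- The discrete action functional `∑_{k < N} L (q_k, q_{k+1})`. -/
def FDMS.action (S : FDMS E Q) {N : ℕ} (q : Fin (N + 1) → Q) : ℝ :=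
  ∑ k : Fin N, S.L (q k.castSucc, q k.succ)

/-- The value of the force along an infinitesimal variation `δ` of the discrete curve `q`:
`∑_{k < N} f (q_k, q_{k+1}) (δq_k, δq_{k+1})`. -/
def FDMS.forceSum (S : FDMS E Q) {N : ℕ} (q : Fin (N + 1) → Q)
    (δ : ∀ k, TangentSpace 𝓘(ℝ, E) (q k)) : ℝ :=
  ∑ k : Fin N, S.f (q k.castSucc, q k.succ) (δ k.castSucc, δ k.succ)

/-- A discrete curve is a trajectory if it satisfies the discrete Lagrange-d'Alembert principle:
for every infinitesimal variation `δ` with fixed endpoints, the variation of the action in the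
direction `δ` plus the force along `δ` vanishes. The variation of the action in the direction `δ`
is its derivative at `t = 0` along any deformation `c` of `q` with velocity `δ`. -/
def FDMS.IsTrajectory (S : FDMS E Q) {N : ℕ} (q : Fin (N + 1) → Q) : Prop :=
  ∀ δ : (∀ k, TangentSpace 𝓘(ℝ, E) (q k)), δ 0 = 0 → δ (Fin.last N) = 0 →
    ∀ c : Fin (N + 1) → ℝ → Q, (∀ k, c k 0 = q k) →
      (∀ k, MDifferentiableAt 𝓘(ℝ, ℝ) 𝓘(ℝ, E) (c k) 0) →
      (∀ k, (mfderiv 𝓘(ℝ, ℝ) 𝓘(ℝ, E) (c k) 0 (1 : ℝ) : E) = δ k) →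
      deriv (fun t ↦ S.action (fun k ↦ c k t)) 0 + S.forceSum q δ = 0

end Systems

/-! ### Group actions, principal bundles, connections -/

section Bundles

variable (E : Type*) [NormedAddCommGroup E] [NormedSpace ℝ E]
  (Q : Type*) [TopologicalSpace Q] [ChartedSpace E Q] [IsManifold 𝓘(ℝ, E) ∞ Q]
  (EG : Type*) [NormedAddCommGroup EG] [NormedSpace ℝ EG]
  (G : Type*) [TopologicalSpace G] [ChartedSpace EG G] [Group G] [LieGroup 𝓘(ℝ, EG) ∞ G]
  (EB : Type*) [NormedAddCommGroup EB] [NormedSpace ℝ EB]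
  [MulAction G Q]

/-- The orbit space `Q / G`, with the quotient topology. -/
abbrev Base : Type _ := MulAction.orbitRel.Quotient G Q

variable {Q} in
/-- The quotient map `π : Q → Q / G`. -/
def proj (q : Q) : Base Q G := Quotient.mk _ q

/-- `π : Q → Q / G` is a (smooth) principal `G`-bundle: the action is smooth, and near each point
of the base (a manifold modelled on `EB`) there is a `G`-equivariant smooth local trivialization,
`G` acting on `U × G` by left translations of the second factor. -/
structure IsPrincipalBundle [ChartedSpace EB (Base Q G)] [IsManifold 𝓘(ℝ, EB) ∞ (Base Q G)] :
    Prop where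
  contMDiff_smul : ContMDiff (𝓘(ℝ, EG).prod 𝓘(ℝ, E)) 𝓘(ℝ, E) ∞ (fun p : G × Q ↦ p.1 • p.2)
  locally_trivial : ∀ b : Base Q G, ∃ (U : Set (Base Q G))
    (t : OpenPartialHomeomorph Q (Base Q G × G)),
    IsOpen U ∧ b ∈ U ∧ t.source = proj G ⁻¹' U ∧ t.target = U ×ˢ Set.univ ∧
    ContMDiffOn 𝓘(ℝ, E) (𝓘(ℝ, EB).prod 𝓘(ℝ, EG)) ∞ t t.source ∧
    ContMDiffOn (𝓘(ℝ, EB).prod 𝓘(ℝ, EG)) 𝓘(ℝ, E) ∞ t.symm t.target ∧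
    ∀ q ∈ t.source, (t q).1 = proj G q ∧ ∀ g : G, t (g • q) = ((t q).1, g * (t q).2)

variable {E Q} in
/-- `G` is a symmetry group of the system: for the diagonal action on `Q × Q`, the discrete
Lagrangian is invariant, and so is the discrete force, as a `1`-form. -/
structure IsSymmetryGroup (S : FDMS E Q) : Prop where
  invariant_L : ∀ (g : G) (p : Q × Q), S.L (g • p) = S.L p
  invariant_f : ∀ (g : G) (p : Q × Q) (δ : TangentSpace (𝓘(ℝ, E).prod 𝓘(ℝ, E)) p),
    S.f (g • p)
      (mfderiv (𝓘(ℝ, E).prod 𝓘(ℝ, E)) (𝓘(ℝ, E).prod 𝓘(ℝ, E)) (fun x : Q × Q ↦ g • x) p δ) =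
    S.f p δ

/-- The Lie algebra of `G`: the tangent space at the identity. -/
abbrev Lie : Type _ := TangentSpace 𝓘(ℝ, EG) (1 : G)

variable {EG G} in
/-- The adjoint action: the derivative at `1` of conjugation by `g`. -/
def Ad (g : G) (ξ : Lie EG G) : Lie EG G :=
  (mfderiv 𝓘(ℝ, EG) 𝓘(ℝ, EG) (fun x : G ↦ g * x * g⁻¹) 1 ξ : EG)

variable {EG G} in
/-- The vector `ξ w ∈ T_w G`: the image of `ξ` under the derivative at `1` of `x ↦ x * w`. -/
def rightTranslate (w : G) (ξ : Lie EG G) : TangentSpace 𝓘(ℝ, EG) w :=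
  (mfderiv 𝓘(ℝ, EG) 𝓘(ℝ, EG) (fun x : G ↦ x * w) 1 ξ : EG)

variable {EG G Q} in
/-- The infinitesimal generator `ξ_Q (q)`, the velocity at `t = 0` of `exp (t ξ) • q`. Since the
velocity of `exp (t ξ)` is `ξ`, this is the image of `ξ` under the derivative at `1` of the orbit
map `g ↦ g • q`. -/
def infGen (ξ : Lie EG G) (q : Q) : TangentSpace 𝓘(ℝ, E) q :=
  (mfderiv 𝓘(ℝ, EG) 𝓘(ℝ, E) (fun g : G ↦ g • q) 1 ξ : E)

/-- A principal connection on `π : Q → Q / G`: a smooth `1`-form with values in the Lie algebra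
that reproduces infinitesimal generators and is equivariant for the adjoint action. -/
structure PrincipalConnection where
  form : ∀ q : Q, TangentSpace 𝓘(ℝ, E) q →L[ℝ] Lie EG G
  contMDiff_form : ContMDiff (M' := EG) 𝓘(ℝ, E).tangent 𝓘(ℝ, EG) ∞
    (fun X : TangentBundle 𝓘(ℝ, E) Q ↦ form X.proj X.snd)
  form_infGen : ∀ (ξ : Lie EG G) (q : Q), form q (infGen E ξ q) = ξ
  form_smul : ∀ (g : G) (q : Q) (δ : TangentSpace 𝓘(ℝ, E) q),
    form (g • q) (mfderiv 𝓘(ℝ, E) 𝓘(ℝ, E) (fun x : Q ↦ g • x) q δ) = Ad g (form q δ)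

/-- An affine discrete connection `A : Q × Q → G` of level `γ : Q → G`. -/
structure AffineDiscreteConnection where
  level : Q → G
  contMDiff_level : ContMDiff 𝓘(ℝ, E) 𝓘(ℝ, EG) ∞ level
  level_smul : ∀ (g : G) (q : Q), level (g • q) = g * level q * g⁻¹
  A : Q × Q → G
  contMDiff_A : ContMDiff (𝓘(ℝ, E).prod 𝓘(ℝ, E)) 𝓘(ℝ, EG) ∞ A
  A_smul : ∀ (g₀ g₁ : G) (q₀ q₁ : Q), A (g₀ • q₀, g₁ • q₁) = g₁ * A (q₀, q₁) * g₀⁻¹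
  A_level : ∀ q : Q, A (q, level q • q) = 1

/-- Two elements of `Q × G` are equivalent if they are in the same orbit of the action
`g • (q, w) = (g • q, g * w * g⁻¹)`. -/
def conjSetoid : Setoid (Q × G) where
  r x y := ∃ g : G, (g • x.1, g * x.2 * g⁻¹) = y
  iseqv :=
    { refl := fun x ↦ ⟨1, by simp⟩
      symm := by
        rintro x y ⟨g, rfl⟩
        exact ⟨g⁻¹, by simp [mul_assoc]⟩
      trans := by
        rintro x y z ⟨g, rfl⟩ ⟨h, rfl⟩
        exact ⟨h * g, by simp [mul_assoc, mul_smul]⟩ }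

/-- The conjugate bundle `G̃ = (Q × G) / G`. -/
abbrev ConjBundle : Type _ := Quotient (conjSetoid Q G)

variable {Q G}

/-- The quotient map `ρ : Q × G → G̃`. -/
def rho (q : Q) (w : G) : ConjBundle Q G := Quotient.mk (conjSetoid Q G) (q, w)

/-- The bundle projection `G̃ → Q / G`, `ρ (q, w) ↦ π q`. -/
def conjProj (v : ConjBundle Q G) : Base Q G :=
  Quotient.lift (s := conjSetoid Q G) (fun x : Q × G ↦ proj G x.1) (by
    rintro x y ⟨g, rfl⟩
    exact (Quotient.sound (s := MulAction.orbitRel G Q) ⟨g, rfl⟩ :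
      proj G (g • x.1) = proj G x.1).symm) v

end Bundles

/-! ### The reduced spaces and the reduced equations -/

section Reduction

variable {E : Type*} [NormedAddCommGroup E] [NormedSpace ℝ E]
  {Q : Type*} [TopologicalSpace Q] [ChartedSpace E Q] [IsManifold 𝓘(ℝ, E) ∞ Q]
  {EG : Type*} [NormedAddCommGroup EG] [NormedSpace ℝ EG]
  {G : Type*} [TopologicalSpace G] [ChartedSpace EG G] [Group G] [LieGroup 𝓘(ℝ, EG) ∞ G]
  [MulAction G Q]

/-- `Υ (q₀, q₁) = (ρ (q₀, A (q₀, q₁)), π q₁)`. -/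
def Upsilon (C : AffineDiscreteConnection E Q EG G) (q₀ q₁ : Q) : ConjBundle Q G × Base Q G :=
  (rho q₀ (C.A (q₀, q₁)), proj G q₁)

/-- `Φ̃ (q₀, q₁) = (q₀, A (q₀, q₁), π q₁)`. -/
def PhiTilde (C : AffineDiscreteConnection E Q EG G) (p : Q × Q) : Q × G × Base Q G :=
  (p.1, C.A p, proj G p.2)

/-- The inverse `Ψ̃` of `Φ̃`: the point `q₁` over `τ` with `A (q₀, q₁) = w` is
`(w * A (q₀, s)⁻¹) • s`, where `s` is any point over `τ`. -/
def PsiTilde (C : AffineDiscreteConnection E Q EG G) (x : Q × G × Base Q G) : Q × Q :=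
  (x.1, (x.2.1 * (C.A (x.1, x.2.2.out))⁻¹) • x.2.2.out)

theorem A_smul_right (C : AffineDiscreteConnection E Q EG G) (g : G) (q₀ q₁ : Q) :
    C.A (q₀, g • q₁) = g * C.A (q₀, q₁) := by
  have h := C.A_smul 1 g q₀ q₁
  simpa using h

theorem proj_smul (g : G) (q : Q) : proj G (g • q) = proj G q :=
  Quotient.sound (s := MulAction.orbitRel G Q) ⟨g, rfl⟩

theorem PhiTilde_PsiTilde (C : AffineDiscreteConnection E Q EG G) (x : Q × G × Base Q G) :
    PhiTilde C (PsiTilde C x) = x := by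
  obtain ⟨q, w, τ⟩ := x
  have h : proj G τ.out = τ := Quotient.out_eq τ
  simp [PhiTilde, PsiTilde, A_smul_right, proj_smul, h]

theorem PsiTilde_PhiTilde (C : AffineDiscreteConnection E Q EG G) (p : Q × Q) :
    PsiTilde C (PhiTilde C p) = p := by
  obtain ⟨q₀, q₁⟩ := p
  obtain ⟨g, hg⟩ : ∃ g : G, g • q₁ = (proj G q₁).out :=
    Quotient.exact (s := MulAction.orbitRel G Q) (Quotient.out_eq (proj G q₁))
  simp [PhiTilde, PsiTilde, ← hg, A_smul_right]

/-- `D₁ A (q₀, q₁) (δ)` for `δ ∈ T_{q₀} Q`. -/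
def D1A (C : AffineDiscreteConnection E Q EG G) (q₀ q₁ : Q) (δ : TangentSpace 𝓘(ℝ, E) q₀) :
    TangentSpace 𝓘(ℝ, EG) (C.A (q₀, q₁)) :=
  mfderiv (𝓘(ℝ, E).prod 𝓘(ℝ, E)) 𝓘(ℝ, EG) C.A (q₀, q₁) ((δ : E), (0 : E))

/-- `D₂ A (q₀, q₁) (δ)` for `δ ∈ T_{q₁} Q`. -/
def D2A (C : AffineDiscreteConnection E Q EG G) (q₀ q₁ : Q) (δ : TangentSpace 𝓘(ℝ, E) q₁) :
    TangentSpace 𝓘(ℝ, EG) (C.A (q₀, q₁)) :=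
  mfderiv (𝓘(ℝ, E).prod 𝓘(ℝ, E)) 𝓘(ℝ, EG) C.A (q₀, q₁) ((0 : E), (δ : E))

/-- The discrete Lagrangian on `Q × G × Q / G`: `Ľ = L ∘ Ψ̃`. -/
def LCheck (C : AffineDiscreteConnection E Q EG G) (S : FDMS E Q) (x : Q × G × Base Q G) : ℝ :=
  S.L (PsiTilde C x)

variable {EB : Type*} [NormedAddCommGroup EB] [NormedSpace ℝ EB]
  [ChartedSpace EB (Base Q G)] [IsManifold 𝓘(ℝ, EB) ∞ (Base Q G)]

variable (EB) in
/-- The differential of `Ľ`. -/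
def dLCheck (C : AffineDiscreteConnection E Q EG G) (S : FDMS E Q) (x : Q × G × Base Q G) :
    TangentSpace (𝓘(ℝ, E).prod (𝓘(ℝ, EG).prod 𝓘(ℝ, EB))) x →L[ℝ] ℝ :=
  mfderiv (𝓘(ℝ, E).prod (𝓘(ℝ, EG).prod 𝓘(ℝ, EB))) 𝓘(ℝ, ℝ) (LCheck C S) x

variable (EB) in
/-- The discrete force on `Q × G × Q / G`: the pullback `f̌ = Ψ̃^* f`. -/
def fCheck (C : AffineDiscreteConnection E Q EG G) (S : FDMS E Q) (x : Q × G × Base Q G) :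
    TangentSpace (𝓘(ℝ, E).prod (𝓘(ℝ, EG).prod 𝓘(ℝ, EB))) x →L[ℝ] ℝ :=
  (S.f (PsiTilde C x)).comp
    (mfderiv (𝓘(ℝ, E).prod (𝓘(ℝ, EG).prod 𝓘(ℝ, EB))) (𝓘(ℝ, E).prod 𝓘(ℝ, E)) (PsiTilde C) x)

/-- First component of a covector on `Q × G × Q / G`. -/
def part1 {x : Q × G × Base Q G}
    (α : TangentSpace (𝓘(ℝ, E).prod (𝓘(ℝ, EG).prod 𝓘(ℝ, EB))) x →L[ℝ] ℝ)
    (δ : TangentSpace 𝓘(ℝ, E) x.1) : ℝ :=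
  α ((δ : E), (0 : EG), (0 : EB))

/-- Second component of a covector on `Q × G × Q / G`. -/
def part2 {x : Q × G × Base Q G}
    (α : TangentSpace (𝓘(ℝ, E).prod (𝓘(ℝ, EG).prod 𝓘(ℝ, EB))) x →L[ℝ] ℝ)
    (δ : TangentSpace 𝓘(ℝ, EG) x.2.1) : ℝ :=
  α ((0 : E), (δ : EG), (0 : EB))

/-- Third component of a covector on `Q × G × Q / G`. -/
def part3 {x : Q × G × Base Q G}
    (α : TangentSpace (𝓘(ℝ, E).prod (𝓘(ℝ, EG).prod 𝓘(ℝ, EB))) x →L[ℝ] ℝ)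
    (δ : TangentSpace 𝓘(ℝ, EB) x.2.2) : ℝ :=
  α ((0 : E), (0 : EG), (δ : EB))

/-- The horizontal lift `h^q (u)` associated to a principal connection: the vector `δ ∈ T_q Q`
with `form q δ = 0` and `Tπ (δ) = u`. -/
def horLift (𝔄 : PrincipalConnection E Q EG G) (q : Q)
    (u : TangentSpace 𝓘(ℝ, EB) (proj G q)) : TangentSpace 𝓘(ℝ, E) q :=
  Classical.epsilon fun δ : TangentSpace 𝓘(ℝ, E) q ↦
    𝔄.form q δ = 0 ∧ mfderiv 𝓘(ℝ, E) 𝓘(ℝ, EB) (proj G) q δ = u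

/-- The covector `φ ∈ T^*_{π(q₁)} (Q / G)` attached to three consecutive points
`q₀, q₁, q₂`, with `w₀ = A (q₀, q₁)`, `τ₁ = π q₁`, `w₁ = A (q₁, q₂)`, `τ₂ = π q₂`. -/
def phi (C : AffineDiscreteConnection E Q EG G) (𝔄 : PrincipalConnection E Q EG G)
    (S : FDMS E Q) (q₀ q₁ q₂ : Q) (u : TangentSpace 𝓘(ℝ, EB) (proj G q₁)) : ℝ :=
  let x₀ : Q × G × Base Q G := PhiTilde C (q₀, q₁)
  let x₁ : Q × G × Base Q G := PhiTilde C (q₁, q₂)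
  let h : TangentSpace 𝓘(ℝ, E) q₁ := horLift 𝔄 q₁ u
  part1 (dLCheck EB C S x₁) h + part3 (dLCheck EB C S x₀) u
    + part2 (dLCheck EB C S x₁) (D1A C q₁ q₂ h)
    + part2 (dLCheck EB C S x₀) (D2A C q₀ q₁ h)
    + part1 (fCheck EB C S x₁) h + part3 (fCheck EB C S x₀) u
    + part2 (fCheck EB C S x₁) (D1A C q₁ q₂ h)
    + part2 (fCheck EB C S x₀) (D2A C q₀ q₁ h)

variable (EB) in
/-- The covector `ψ ∈ 𝔤^*` attached to three consecutive points `q₀, q₁, q₂`, with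
`w₀ = A (q₀, q₁)`, `τ₁ = π q₁`, `w₁ = A (q₁, q₂)`, `τ₂ = π q₂`. For a covector `α` at `w`, the
covector `α w⁻¹ ∈ 𝔤^*` is its right translate, `(α w⁻¹) (ξ) = α (ξ w)`. -/
def psi (C : AffineDiscreteConnection E Q EG G)
    (S : FDMS E Q) (q₀ q₁ q₂ : Q) (ξ : Lie EG G) : ℝ :=
  let x₀ : Q × G × Base Q G := PhiTilde C (q₀, q₁)
  let x₁ : Q × G × Base Q G := PhiTilde C (q₁, q₂)
  let η : TangentSpace 𝓘(ℝ, E) q₁ := infGen E ξ q₁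
  (part2 (dLCheck EB C S x₀) (rightTranslate (C.A (q₀, q₁)) ξ)
      - part2 (dLCheck EB C S x₁) (rightTranslate (C.A (q₁, q₂)) ξ))
    + (part1 (fCheck EB C S x₁) η
      + part2 (fCheck EB C S x₁) (D1A C q₁ q₂ η)
      + part2 (fCheck EB C S x₀) (D2A C q₀ q₁ η))

variable (EB) in
/-- The reduced equations for a discrete curve `((v_0, τ_1), …, (v_{N-1}, τ_N))` in
`G̃ × Q / G`; here `τ k` stands for `τ_{k+1}`. They are imposed on any two consecutive points of
the curve, through points `q₀, q₁, q₂` of `Q` lying over them; by equivariance the choice of these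
points is irrelevant, so that one choice is asked for. -/
def ReducedEquations (C : AffineDiscreteConnection E Q EG G) (𝔄 : PrincipalConnection E Q EG G)
    (S : FDMS E Q) {N : ℕ} (v : Fin N → ConjBundle Q G) (τ : Fin N → Base Q G) : Prop :=
  ∀ (k : ℕ) (hk : k + 1 < N), ∃ q₀ q₁ q₂ : Q,
    Upsilon C q₀ q₁ = (v ⟨k, by omega⟩, τ ⟨k, by omega⟩) ∧
    Upsilon C q₁ q₂ = (v ⟨k + 1, hk⟩, τ ⟨k + 1, hk⟩) ∧
    (∀ u : TangentSpace 𝓘(ℝ, EB) (proj G q₁), phi C 𝔄 S q₀ q₁ q₂ u = 0) ∧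
    (∀ ξ : Lie EG G, psi EB C S q₀ q₁ q₂ ξ = 0)

end Reduction

end FDMech

end

/-!
The discrete action has derivative `∑ dL (q_k, q_{k+1}) (δ_k, δ_{k+1})`, so after summation by parts
a discrete curve is a trajectory as soon as the covector
`D₂ L (q_{k-1}, q_k) + f² (q_{k-1}, q_k) + D₁ L (q_k, q_{k+1}) + f¹ (q_k, q_{k+1})` on `T_{q_k} Q`
vanishes at each interior point (`FDMS.isTrajectory_of_eulerLagrange`).

A tangent vector at `q_k` is the sum of a horizontal lift and an infinitesimal generator: the
kernel of `Tπ` consists of generators, as one sees by differentiating `x = a x • s (π x)` for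
a local section `s` (`IsPrincipalBundle.exists_infGen_eq`). It therefore suffices to evaluate the
covector on these two kinds of vectors. As `L = Ľ ∘ Φ̃` and `f = Φ̃^* f̌`, the chain rule rewrites
it in terms of `Ľ`, `f̌` and the partial derivatives of `A`. On horizontal lifts the result is `φ`
(`IsPrincipalBundle.eulerLagrange_horLift`). On generators it is `ψ`, once the invariance of `L` has
turned the variation of `L (q_k, q_{k+1})` in its first point into minus the one in its second
point, where `D₂ A` is a right translation (`IsPrincipalBundle.eulerLagrange_infGen`).

The reduced equations are given at some points above `(v, τ)`, not at those of the lifted curve.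
The action being free, two triples above the same data differ by the diagonal action of one group
element, and the covector is equivariant for it (`IsPrincipalBundle.eulerLagrange_smul`). Freeness
also gives the uniqueness of the lifted curve, while its existence comes from `Φ̃` being onto.
-/

namespace FDMech

open Filter Topology

variable {E : Type*} [NormedAddCommGroup E] [NormedSpace ℝ E]
  {Q : Type*} [TopologicalSpace Q] [ChartedSpace E Q] [IsManifold 𝓘(ℝ, E) ∞ Q]
  {EG : Type*} [NormedAddCommGroup EG] [NormedSpace ℝ EG]
  {G : Type*} [TopologicalSpace G] [ChartedSpace EG G] [Group G] [LieGroup 𝓘(ℝ, EG) ∞ G]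
  [MulAction G Q]
  {EB : Type*} [NormedAddCommGroup EB] [NormedSpace ℝ EB]
  [ChartedSpace EB (Base Q G)] [IsManifold 𝓘(ℝ, EB) ∞ (Base Q G)]

/-! ### Local structure of a principal bundle -/

theorem exists_smul_eq_of_proj_eq {q q' : Q} (h : proj G q = proj G q') : ∃ g : G, g • q = q' :=
  Quotient.exact (s := MulAction.orbitRel G Q) h.symm

theorem exists_smul_eq_of_rho_eq {q q' : Q} {w w' : G} (h : rho q w = rho q' w') :
    ∃ g : G, g • q = q' ∧ g * w * g⁻¹ = w' := by
  obtain ⟨g, hg⟩ := Quotient.exact (s := conjSetoid Q G) h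
  exact ⟨g, congrArg Prod.fst hg, congrArg Prod.snd hg⟩

namespace IsPrincipalBundle

variable (hπ : IsPrincipalBundle E Q EG G EB)
include hπ

theorem eq_one_of_smul_eq {g : G} {q : Q} (h : g • q = q) : g = 1 := by
  obtain ⟨U, t, -, hU, hs, -, -, -, ht⟩ := hπ.locally_trivial (proj G q)
  have hq : q ∈ t.source := by rw [hs]; exact hU
  have h1 := (ht q hq).2 g
  rw [h] at h1
  simpa using congrArg Prod.snd h1

theorem smul_left_injective {g g' : G} {q : Q} (h : g • q = g' • q) : g = g' := by
  have : (g'⁻¹ * g) • q = q := by rw [mul_smul, h, inv_smul_smul]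
  exact (inv_mul_eq_one.1 (hπ.eq_one_of_smul_eq this)).symm

theorem mdifferentiableAt_proj (q : Q) :
    MDifferentiableAt 𝓘(ℝ, E) 𝓘(ℝ, EB) (proj G : Q → Base Q G) q := by
  obtain ⟨U, t, -, hU, hs, -, ht, -, h⟩ := hπ.locally_trivial (proj G q)
  have hq : q ∈ t.source := by rw [hs]; exact hU
  have hn := t.open_source.mem_nhds hq
  have h1 := ((ht q hq).contMDiffAt hn).mdifferentiableAt (by simp)
  refine (mdifferentiableAt_fst.comp q h1).congr_of_eventuallyEq ?_
  filter_upwards [hn] with x hx using (h x hx).1.symm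

theorem mdifferentiableAt_smul (p : G × Q) :
    MDifferentiableAt (𝓘(ℝ, EG).prod 𝓘(ℝ, E)) 𝓘(ℝ, E) (fun p : G × Q ↦ p.1 • p.2) p :=
  hπ.contMDiff_smul.contMDiffAt.mdifferentiableAt (by simp)

theorem mdifferentiableAt_const_smul (g : G) (q : Q) :
    MDifferentiableAt 𝓘(ℝ, E) 𝓘(ℝ, E) (fun x : Q ↦ g • x) q :=
  (hπ.mdifferentiableAt_smul (g, q)).comp (f := fun x : Q ↦ (g, x)) q
    (mdifferentiableAt_const.prodMk mdifferentiableAt_id)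

theorem mdifferentiableAt_smul_const (g : G) (q : Q) :
    MDifferentiableAt 𝓘(ℝ, EG) 𝓘(ℝ, E) (fun x : G ↦ x • q) g :=
  (hπ.mdifferentiableAt_smul (g, q)).comp (f := fun x : G ↦ (x, q)) g
    (mdifferentiableAt_id.prodMk mdifferentiableAt_const)

/-- Near each point `q` there are a section `s` of `π` through `q` and a `G`-valued function `a`
with `x = a x • s (π x)`, both differentiable at the relevant point. They are all that the local
trivializations are needed for. -/
theorem exists_local_section (q : Q) : ∃ (s : Base Q G → Q) (a : Q → G),
    MDifferentiableAt 𝓘(ℝ, EB) 𝓘(ℝ, E) s (proj G q) ∧ MDifferentiableAt 𝓘(ℝ, E) 𝓘(ℝ, EG) a q ∧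
    s (proj G q) = q ∧ a q = 1 ∧ (∀ᶠ b in 𝓝 (proj G q), proj G (s b) = b) ∧
    ∀ᶠ x in 𝓝 q, a x • s (proj G x) = x := by
  obtain ⟨U, t, hUo, hU, hs, htt, ht, hts, h⟩ := hπ.locally_trivial (proj G q)
  have hq : q ∈ t.source := by rw [hs]; exact hU
  have hn := t.open_source.mem_nhds hq
  have h1 := ((ht q hq).contMDiffAt hn).mdifferentiableAt (by simp)
  have hmem (b : Base Q G) (hb : b ∈ U) (g : G) : (b, g) ∈ t.target := by
    rw [htt]; exact ⟨hb, trivial⟩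
  have hproj (b : Base Q G) (hb : b ∈ U) (g : G) : proj G (t.symm (b, g)) = b := by
    rw [← (h _ (t.map_target (hmem b hb g))).1, t.right_inv (hmem b hb g)]
  have h2 := ((hts _ (hmem _ hU (t q).2)).contMDiffAt
    (t.open_target.mem_nhds (hmem _ hU (t q).2))).mdifferentiableAt (by simp)
  refine ⟨fun b ↦ t.symm (b, (t q).2), fun x ↦ (t x).2 * (t q).2⁻¹, ?_, ?_, ?_, ?_, ?_, ?_⟩
  · exact h2.comp (f := fun b : Base Q G ↦ (b, (t q).2)) (proj G q)
      (mdifferentiableAt_id.prodMk mdifferentiableAt_const)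
  · have h3 : MDifferentiableAt 𝓘(ℝ, EG) 𝓘(ℝ, EG) (fun x : G ↦ x * (t q).2⁻¹) (t q).2 :=
      (contMDiff_mul_right (I := 𝓘(ℝ, EG)) (n := ∞)).contMDiffAt.mdifferentiableAt (by simp)
    exact h3.comp (f := fun x ↦ (t x).2) q (mdifferentiableAt_snd.comp q h1)
  · have : (proj G q, (t q).2) = t q := by rw [← (h q hq).1]
    simp only [this, t.left_inv hq]
  · simp
  · filter_upwards [hUo.mem_nhds hU] with b hb using hproj b hb _
  · filter_upwards [hn] with x hx
    have hx' : proj G x ∈ U := by rw [hs] at hx; exact hx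
    have hy := t.map_target (hmem _ hx' (t q).2)
    refine t.injOn ?_ hx ?_
    · rw [hs, Set.mem_preimage, proj_smul, hproj _ hx']; exact hx'
    · rw [(h _ hy).2, t.right_inv (hmem _ hx' _)]
      simp [← (h x hx).1]

/-- Infinitesimal generators are vertical. -/
theorem mfderiv_proj_infGen (q : Q) (ξ : Lie EG G) :
    mfderiv 𝓘(ℝ, E) 𝓘(ℝ, EB) (proj G) q (infGen E ξ q) = 0 := by
  have h := mfderiv_comp_apply_of_eq (f := fun g : G ↦ g • q) (g := (proj G : Q → Base Q G))
    (x := (1 : G)) (y := q) (I := 𝓘(ℝ, EG)) (I' := 𝓘(ℝ, E)) (I'' := 𝓘(ℝ, EB))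
    (hπ.mdifferentiableAt_proj q) (hπ.mdifferentiableAt_smul_const 1 q) (one_smul _ _) ξ
  have h0 : (proj G : Q → Base Q G) ∘ (fun g : G ↦ g • q) = fun _ ↦ proj G q :=
    funext fun g ↦ proj_smul g q
  rw [h0, mfderiv_const] at h
  exact h.symm

/-- Tangent vectors of the base are lifted by local sections. -/
theorem mfderiv_proj_surjective (q : Q) (u : TangentSpace 𝓘(ℝ, EB) (proj G q)) :
    ∃ δ : TangentSpace 𝓘(ℝ, E) q, mfderiv 𝓘(ℝ, E) 𝓘(ℝ, EB) (proj G) q δ = u := by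
  obtain ⟨s, -, hs, -, hsq, -, hps, -⟩ := hπ.exists_local_section q
  have h := mfderiv_comp_apply_of_eq (f := s) (g := (proj G : Q → Base Q G))
    (x := proj G q) (y := q) (I := 𝓘(ℝ, EB)) (I' := 𝓘(ℝ, E)) (I'' := 𝓘(ℝ, EB))
    (hπ.mdifferentiableAt_proj q) hs hsq u
  have h0 : (proj G : Q → Base Q G) ∘ s =ᶠ[𝓝 (proj G q)] id := hps
  rw [h0.mfderiv_eq, mfderiv_id] at h
  exact ⟨_, h.symm⟩

/-- The kernel of `Tπ` consists of infinitesimal generators: differentiate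
`x = a x • s (π x)`. -/
theorem exists_infGen_eq {q : Q} {δ : TangentSpace 𝓘(ℝ, E) q}
    (hδ : mfderiv 𝓘(ℝ, E) 𝓘(ℝ, EB) (proj G : Q → Base Q G) q δ = 0) :
    ∃ ξ : Lie EG G, infGen E ξ q = δ := by
  obtain ⟨s, a, hs, ha, hsq, haq, -, hx⟩ := hπ.exists_local_section q
  have hp := hπ.mdifferentiableAt_proj q
  have hsp := hs.comp q hp
  have h0 : (fun p : G × Q ↦ p.1 • p.2) ∘ (fun x ↦ (a x, (s ∘ proj G) x)) =ᶠ[𝓝 q] id := hx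
  have h := mfderiv_comp_apply_of_eq (f := fun x ↦ (a x, (s ∘ proj G) x))
    (g := fun p : G × Q ↦ p.1 • p.2) (x := q) (y := (1, q))
    (hπ.mdifferentiableAt_smul (1, q)) (ha.prodMk hsp)
    (by simp [haq, hsq]) δ
  rw [h0.mfderiv_eq, mfderiv_id, mfderiv_prodMk ha hsp] at h
  refine ⟨(mfderiv 𝓘(ℝ, E) 𝓘(ℝ, EG) a q δ : EG), ?_⟩
  have h1 : mfderiv 𝓘(ℝ, E) 𝓘(ℝ, E) (s ∘ proj G) q δ = 0 := by
    rw [mfderiv_comp_apply q hs hp, hδ, map_zero]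
  have h2 := mfderiv_comp_apply (f := fun x : G ↦ (x, q))
    (g := fun p : G × Q ↦ p.1 • p.2) (x := (1 : G)) (I := 𝓘(ℝ, EG))
    (hπ.mdifferentiableAt_smul (1, q)) (mdifferentiableAt_id.prodMk mdifferentiableAt_const)
    (mfderiv 𝓘(ℝ, E) 𝓘(ℝ, EG) a q δ : EG)
  rw [mfderiv_prod_left] at h2
  refine h2.trans (Eq.trans ?_ h.symm)
  refine congrArg (mfderiv (𝓘(ℝ, EG).prod 𝓘(ℝ, E)) 𝓘(ℝ, E) (fun p : G × Q ↦ p.1 • p.2) (1, q)) ?_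
  exact Prod.ext rfl h1.symm

end IsPrincipalBundle

/-! ### Chain rule for `Φ̃` -/

theorem AffineDiscreteConnection.mdifferentiableAt_A (C : AffineDiscreteConnection E Q EG G)
    (p : Q × Q) : MDifferentiableAt (𝓘(ℝ, E).prod 𝓘(ℝ, E)) 𝓘(ℝ, EG) C.A p :=
  C.contMDiff_A.contMDiffAt.mdifferentiableAt (by simp)

theorem FDMS.mdifferentiableAt_L (S : FDMS E Q) (p : Q × Q) :
    MDifferentiableAt (𝓘(ℝ, E).prod 𝓘(ℝ, E)) 𝓘(ℝ, ℝ) S.L p :=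
  S.contMDiff_L.contMDiffAt.mdifferentiableAt (by simp)

theorem PsiTilde_eq (C : AffineDiscreteConnection E Q EG G) (x : Q × G × Base Q G) {r : Q}
    (hr : proj G r = x.2.2) : PsiTilde C x = (x.1, (x.2.1 * (C.A (x.1, r))⁻¹) • r) := by
  have h : PhiTilde C (x.1, (x.2.1 * (C.A (x.1, r))⁻¹) • r) = x := by
    simp [PhiTilde, A_smul_right, proj_smul, hr]
  rw [← PsiTilde_PhiTilde C (x.1, (x.2.1 * (C.A (x.1, r))⁻¹) • r), h]

namespace IsPrincipalBundle

variable (hπ : IsPrincipalBundle E Q EG G EB)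
include hπ

/-- `Ψ̃` is differentiable: locally its third argument may be lifted by a differentiable section
instead of an arbitrary choice of representatives. -/
theorem mdifferentiableAt_PsiTilde (C : AffineDiscreteConnection E Q EG G)
    (x : Q × G × Base Q G) :
    MDifferentiableAt (𝓘(ℝ, E).prod (𝓘(ℝ, EG).prod 𝓘(ℝ, EB))) (𝓘(ℝ, E).prod 𝓘(ℝ, E))
      (PsiTilde C) x := by
  obtain ⟨q, w, b⟩ := x
  obtain ⟨r, rfl⟩ : ∃ r, proj G r = b := Quotient.exists_rep b
  obtain ⟨s, -, hs, -, -, -, hps, -⟩ := hπ.exists_local_section r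
  let J := 𝓘(ℝ, E).prod (𝓘(ℝ, EG).prod 𝓘(ℝ, EB))
  let x : Q × G × Base Q G := (q, w, proj G r)
  have h1 : MDifferentiableAt J 𝓘(ℝ, E) (fun y : Q × G × Base Q G ↦ y.1) x :=
    mdifferentiableAt_fst
  have h2 : MDifferentiableAt J (𝓘(ℝ, EG).prod 𝓘(ℝ, EB)) (fun y : Q × G × Base Q G ↦ y.2) x :=
    mdifferentiableAt_snd
  have h3 : MDifferentiableAt J 𝓘(ℝ, EG) (fun y : Q × G × Base Q G ↦ y.2.1) x :=
    mdifferentiableAt_fst.comp x h2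
  have h4 : MDifferentiableAt J 𝓘(ℝ, EB) (fun y : Q × G × Base Q G ↦ y.2.2) x :=
    mdifferentiableAt_snd.comp x h2
  have h5 : MDifferentiableAt J 𝓘(ℝ, E) (fun y : Q × G × Base Q G ↦ s y.2.2) x :=
    MDifferentiableAt.comp (g := s) x hs h4
  have h6 : MDifferentiableAt J 𝓘(ℝ, EG) (fun y : Q × G × Base Q G ↦ C.A (y.1, s y.2.2)) x :=
    MDifferentiableAt.comp x (C.mdifferentiableAt_A _) (h1.prodMk h5)
  have h7 : MDifferentiableAt J 𝓘(ℝ, EG)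
      (fun y : Q × G × Base Q G ↦ (C.A (y.1, s y.2.2))⁻¹) x :=
    MDifferentiableAt.comp (g := fun g : G ↦ g⁻¹) x
      ((contMDiff_inv 𝓘(ℝ, EG) ∞).contMDiffAt.mdifferentiableAt (by simp)) h6
  have h8 : MDifferentiableAt J 𝓘(ℝ, EG)
      (fun y : Q × G × Base Q G ↦ y.2.1 * (C.A (y.1, s y.2.2))⁻¹) x :=
    MDifferentiableAt.comp (g := fun p : G × G ↦ p.1 * p.2) x
      ((contMDiff_mul 𝓘(ℝ, EG) ∞).contMDiffAt.mdifferentiableAt (by simp)) (h3.prodMk h7)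
  have h9 : MDifferentiableAt J 𝓘(ℝ, E)
      (fun y : Q × G × Base Q G ↦ (y.2.1 * (C.A (y.1, s y.2.2))⁻¹) • s y.2.2) x :=
    MDifferentiableAt.comp (g := fun p : G × Q ↦ p.1 • p.2) x
      (hπ.mdifferentiableAt_smul _) (h8.prodMk h5)
  refine (h1.prodMk h9).congr_of_eventuallyEq ?_
  filter_upwards [(h4.continuousAt : Tendsto _ _ _).eventually hps] with y hy
    using PsiTilde_eq C y hy

theorem mfderiv_PhiTilde_apply (C : AffineDiscreteConnection E Q EG G) (q₀ q₁ : Q)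
    (δ₀ : TangentSpace 𝓘(ℝ, E) q₀) (δ₁ : TangentSpace 𝓘(ℝ, E) q₁) :
    mfderiv (𝓘(ℝ, E).prod 𝓘(ℝ, E)) (𝓘(ℝ, E).prod (𝓘(ℝ, EG).prod 𝓘(ℝ, EB))) (PhiTilde C)
      (q₀, q₁) (δ₀, δ₁) =
    (δ₀, mfderiv (𝓘(ℝ, E).prod 𝓘(ℝ, E)) 𝓘(ℝ, EG) C.A (q₀, q₁) (δ₀, δ₁),
      mfderiv 𝓘(ℝ, E) 𝓘(ℝ, EB) (proj G) q₁ δ₁) := by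
  have h1 : MDifferentiableAt (𝓘(ℝ, E).prod 𝓘(ℝ, E)) 𝓘(ℝ, E) (Prod.fst : Q × Q → Q) (q₀, q₁) :=
    mdifferentiableAt_fst
  have h2 : MDifferentiableAt (𝓘(ℝ, E).prod 𝓘(ℝ, E)) 𝓘(ℝ, E) (Prod.snd : Q × Q → Q) (q₀, q₁) :=
    mdifferentiableAt_snd
  have hp := hπ.mdifferentiableAt_proj q₁
  have hA := C.mdifferentiableAt_A (q₀, q₁)
  have h3 := MDifferentiableAt.comp (q₀, q₁) (g := (proj G : Q → Base Q G)) hp h2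
  have e : PhiTilde C = fun p ↦ (p.1, (C.A p, (proj G ∘ Prod.snd : Q × Q → Base Q G) p)) := rfl
  have h4 := mfderiv_comp_apply (q₀, q₁) (g := (proj G : Q → Base Q G)) hp h2 (δ₀, δ₁)
  rw [mfderiv_snd] at h4
  rw [e, mfderiv_prodMk h1 (hA.prodMk h3), mfderiv_prodMk hA h3, mfderiv_fst]
  exact Prod.ext rfl (Prod.ext rfl h4)

theorem mdifferentiableAt_PhiTilde (C : AffineDiscreteConnection E Q EG G) (p : Q × Q) :
    MDifferentiableAt (𝓘(ℝ, E).prod 𝓘(ℝ, E)) (𝓘(ℝ, E).prod (𝓘(ℝ, EG).prod 𝓘(ℝ, EB)))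
      (PhiTilde C) p :=
  mdifferentiableAt_fst.prodMk ((C.mdifferentiableAt_A p).prodMk
    (MDifferentiableAt.comp p (hπ.mdifferentiableAt_proj p.2) mdifferentiableAt_snd))

/-- `Φ̃^* dĽ = dL`. -/
theorem dLCheck_mfderiv_PhiTilde (C : AffineDiscreteConnection E Q EG G) (S : FDMS E Q)
    (p : Q × Q) (δ : TangentSpace (𝓘(ℝ, E).prod 𝓘(ℝ, E)) p) :
    dLCheck EB C S (PhiTilde C p)
      (mfderiv (𝓘(ℝ, E).prod 𝓘(ℝ, E)) (𝓘(ℝ, E).prod (𝓘(ℝ, EG).prod 𝓘(ℝ, EB))) (PhiTilde C) p δ) =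
    mfderiv (𝓘(ℝ, E).prod 𝓘(ℝ, E)) 𝓘(ℝ, ℝ) S.L p δ := by
  have e : LCheck C S ∘ PhiTilde C = S.L := funext fun p ↦ by simp [LCheck, PsiTilde_PhiTilde]
  rw [dLCheck, ← e]
  exact (mfderiv_comp_apply p (MDifferentiableAt.comp _ (S.mdifferentiableAt_L _)
    (hπ.mdifferentiableAt_PsiTilde C _)) (hπ.mdifferentiableAt_PhiTilde C p) δ).symm

/-- `Φ̃^* f̌ = f`. -/
theorem fCheck_mfderiv_PhiTilde (C : AffineDiscreteConnection E Q EG G) (S : FDMS E Q)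
    (p : Q × Q) (δ : TangentSpace (𝓘(ℝ, E).prod 𝓘(ℝ, E)) p) :
    fCheck EB C S (PhiTilde C p)
      (mfderiv (𝓘(ℝ, E).prod 𝓘(ℝ, E)) (𝓘(ℝ, E).prod (𝓘(ℝ, EG).prod 𝓘(ℝ, EB))) (PhiTilde C) p δ) =
    S.f p δ := by
  have h := mfderiv_comp_apply p (hπ.mdifferentiableAt_PsiTilde C _)
    (hπ.mdifferentiableAt_PhiTilde C p) δ
  have e : PsiTilde C ∘ PhiTilde C = id := funext (PsiTilde_PhiTilde C)
  rw [e, mfderiv_id] at h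
  -- `Ψ̃ (Φ̃ p)` equals `p` only propositionally.
  have hf : ∀ p' : Q × Q, p' = p → ∀ d : E × E, (S.f p' d : ℝ) = S.f p d := by
    rintro _ rfl d; rfl
  rw [fCheck]
  exact (congrArg (S.f _) h.symm).trans (hf _ (PsiTilde_PhiTilde C p) δ)

/-- A covector on `Q × G × Q / G` pulled back by `Φ̃`, along a variation of the first point. -/
theorem apply_mfderiv_PhiTilde_left (C : AffineDiscreteConnection E Q EG G) (q₀ q₁ : Q)
    (α : TangentSpace (𝓘(ℝ, E).prod (𝓘(ℝ, EG).prod 𝓘(ℝ, EB))) (PhiTilde C (q₀, q₁)) →L[ℝ] ℝ)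
    (δ : TangentSpace 𝓘(ℝ, E) q₀) :
    α (mfderiv (𝓘(ℝ, E).prod 𝓘(ℝ, E)) (𝓘(ℝ, E).prod (𝓘(ℝ, EG).prod 𝓘(ℝ, EB))) (PhiTilde C)
      (q₀, q₁) ((δ : E), (0 : E))) = part1 α δ + part2 α (D1A C q₀ q₁ δ) := by
  refine Eq.trans (congrArg α ?_) (map_add α ((δ : E), (0 : EG), (0 : EB))
    ((0 : E), (D1A C q₀ q₁ δ : EG), (0 : EB)))
  refine ((hπ.mfderiv_PhiTilde_apply C q₀ q₁ δ (0 : E)).trans ?_)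
  refine Prod.ext (add_zero (δ : E)).symm (Prod.ext (zero_add (D1A C q₀ q₁ δ : EG)).symm ?_)
  exact (map_zero _).trans (zero_add (0 : EB)).symm

/-- A covector on `Q × G × Q / G` pulled back by `Φ̃`, along a variation of the second point. -/
theorem apply_mfderiv_PhiTilde_right (C : AffineDiscreteConnection E Q EG G) (q₀ q₁ : Q)
    (α : TangentSpace (𝓘(ℝ, E).prod (𝓘(ℝ, EG).prod 𝓘(ℝ, EB))) (PhiTilde C (q₀, q₁)) →L[ℝ] ℝ)
    (δ : TangentSpace 𝓘(ℝ, E) q₁) :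
    α (mfderiv (𝓘(ℝ, E).prod 𝓘(ℝ, E)) (𝓘(ℝ, E).prod (𝓘(ℝ, EG).prod 𝓘(ℝ, EB))) (PhiTilde C)
      (q₀, q₁) ((0 : E), (δ : E))) =
    part2 α (D2A C q₀ q₁ δ) + part3 α (mfderiv 𝓘(ℝ, E) 𝓘(ℝ, EB) (proj G) q₁ δ) := by
  refine Eq.trans (congrArg α ?_) (map_add α ((0 : E), (D2A C q₀ q₁ δ : EG), (0 : EB))
    ((0 : E), (0 : EG), (mfderiv 𝓘(ℝ, E) 𝓘(ℝ, EB) (proj G) q₁ δ : EB)))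
  refine ((hπ.mfderiv_PhiTilde_apply C q₀ q₁ (0 : E) δ).trans ?_)
  exact Prod.ext (add_zero (0 : E)).symm (Prod.ext (add_zero (D2A C q₀ q₁ δ : EG)).symm
    (zero_add (mfderiv 𝓘(ℝ, E) 𝓘(ℝ, EB) (proj G) q₁ δ : EB)).symm)

/-- Differentiate `A (q₀, g • q₁) = g * A (q₀, q₁)` at `g = 1`. -/
theorem D2A_infGen (C : AffineDiscreteConnection E Q EG G) (q₀ q₁ : Q) (ξ : Lie EG G) :
    D2A C q₀ q₁ (infGen E ξ q₁) = rightTranslate (C.A (q₀, q₁)) ξ := by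
  have hc : MDifferentiableAt 𝓘(ℝ, EG) 𝓘(ℝ, E) (fun _ : G ↦ q₀) 1 := mdifferentiableAt_const
  have ho := hπ.mdifferentiableAt_smul_const 1 q₁
  have h := mfderiv_comp_apply_of_eq (f := fun g : G ↦ (q₀, g • q₁)) (g := C.A)
    (x := (1 : G)) (y := (q₀, q₁)) (C.mdifferentiableAt_A _) (hc.prodMk ho) (by simp) ξ
  have e : C.A ∘ (fun g : G ↦ (q₀, g • q₁)) = fun g ↦ g * C.A (q₀, q₁) :=
    funext fun g ↦ A_smul_right C g q₀ q₁
  rw [e, mfderiv_prodMk hc ho, mfderiv_const] at h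
  exact h.symm

end IsPrincipalBundle

/-! ### The forced discrete Euler-Lagrange equations -/

/-- The differential of the discrete Lagrangian. -/
noncomputable def FDMS.dL (S : FDMS E Q) (p : Q × Q) :
    TangentSpace (𝓘(ℝ, E).prod 𝓘(ℝ, E)) p →L[ℝ] ℝ :=
  mfderiv (𝓘(ℝ, E).prod 𝓘(ℝ, E)) 𝓘(ℝ, ℝ) S.L p

/-- The `1`-form `dL + f` on `Q × Q`. -/
noncomputable def FDMS.totalForm (S : FDMS E Q) (p : Q × Q) :
    TangentSpace (𝓘(ℝ, E).prod 𝓘(ℝ, E)) p →L[ℝ] ℝ :=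
  S.dL p + S.f p

/-- The forced discrete Euler-Lagrange covector at the middle one of three consecutive points:
`D₂ L (q₀, q₁) + f² (q₀, q₁) + D₁ L (q₁, q₂) + f¹ (q₁, q₂)`. -/
noncomputable def FDMS.eulerLagrange (S : FDMS E Q) (q₀ q₁ q₂ : Q)
    (δ : TangentSpace 𝓘(ℝ, E) q₁) : ℝ :=
  S.totalForm (q₀, q₁) ((0 : E), (δ : E)) + S.totalForm (q₁, q₂) ((δ : E), (0 : E))

theorem FDMS.totalForm_split (S : FDMS E Q) (p : Q × Q) (a b : E) :
    S.totalForm p (a, b) = S.totalForm p (a, (0 : E)) + S.totalForm p ((0 : E), b) := by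
  refine Eq.trans (congrArg (S.totalForm p) ?_)
    (map_add (S.totalForm p) (a, (0 : E)) ((0 : E), b))
  exact Prod.ext (add_zero a).symm (zero_add b).symm

theorem FDMS.eulerLagrange_add (S : FDMS E Q) (q₀ q₁ q₂ : Q) (a b : TangentSpace 𝓘(ℝ, E) q₁) :
    S.eulerLagrange q₀ q₁ q₂ (a + b) =
      S.eulerLagrange q₀ q₁ q₂ a + S.eulerLagrange q₀ q₁ q₂ b := by
  have h0 := map_add (S.totalForm (q₀, q₁)) ((0 : E), (a : E)) ((0 : E), (b : E))
  have h1 := map_add (S.totalForm (q₁, q₂)) ((a : E), (0 : E)) ((b : E), (0 : E))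
  have e0 : (((0 : E), (a : E)) + ((0 : E), (b : E)) : E × E) = ((0 : E), (a + b : E)) :=
    Prod.ext (add_zero 0) rfl
  have e1 : (((a : E), (0 : E)) + ((b : E), (0 : E)) : E × E) = ((a + b : E), (0 : E)) :=
    Prod.ext rfl (add_zero 0)
  have h0' : S.totalForm (q₀, q₁) ((0 : E), (a + b : E)) = _ :=
    (congrArg (S.totalForm (q₀, q₁)) e0.symm).trans h0
  have h1' : S.totalForm (q₁, q₂) ((a + b : E), (0 : E)) = _ :=
    (congrArg (S.totalForm (q₁, q₂)) e1.symm).trans h1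
  have := congrArg₂ (· + ·) h0' h1'
  exact this.trans (add_add_add_comm _ _ _ _)

/-- Summation by parts with vanishing boundary terms. -/
theorem sum_add_sum_eq_zero_of_shift {M : ℕ} {A B T T' : Fin (M + 1) → ℝ}
    (h : ∀ k, A k + B k = T k + T' k) (h0 : T 0 = 0) (hM : T' (Fin.last M) = 0)
    (hk : ∀ k : Fin M, T' k.castSucc + T k.succ = 0) : ∑ k, A k + ∑ k, B k = 0 := by
  rw [← Finset.sum_add_distrib, Finset.sum_congr rfl fun k _ ↦ h k, Finset.sum_add_distrib,
    Fin.sum_univ_succ, Fin.sum_univ_castSucc (f := T'), h0, hM, zero_add, add_zero,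
    ← Finset.sum_add_distrib]
  exact Finset.sum_eq_zero fun k _ ↦ by rw [add_comm, hk]

/-- The discrete Lagrange-d'Alembert principle follows from the forced discrete Euler-Lagrange
equations, by summation by parts. -/
theorem FDMS.isTrajectory_of_eulerLagrange (S : FDMS E Q) {M : ℕ} (q : Fin (M + 2) → Q)
    (h : ∀ (k : Fin M) (δ : TangentSpace 𝓘(ℝ, E) (q k.succ.castSucc)),
      S.eulerLagrange (q k.castSucc.castSucc) (q k.succ.castSucc) (q k.succ.succ) δ = 0) :
    S.IsTrajectory q := by
  intro δ h0 hN c hc hd hv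
  have hterm (k : Fin (M + 1)) : HasDerivAt (fun t ↦ S.L (c k.castSucc t, c k.succ t))
      (S.dL (q k.castSucc, q k.succ) ((δ k.castSucc : E), (δ k.succ : E))) 0 := by
    have h1 := (hd k.castSucc).hasMFDerivAt.prodMk (hd k.succ).hasMFDerivAt
    have h2 := (S.mdifferentiableAt_L (c k.castSucc 0, c k.succ 0)).hasMFDerivAt
    have h3 := HasMFDerivAt.comp (0 : ℝ) h2 h1
    -- The base point `(c k 0, c (k + 1) 0)` equals `(q_k, q_{k+1})` only propositionally.
    have e : ∀ p' : Q × Q, p' = (q k.castSucc, q k.succ) → ∀ d d' : E × E, d = d' →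
        S.dL p' d = S.dL (q k.castSucc, q k.succ) d' := by
      rintro _ rfl d _ rfl; rfl
    obtain ⟨D, hD, hD1⟩ : ∃ D : ℝ →L[ℝ] ℝ,
        HasFDerivAt (fun t ↦ S.L (c k.castSucc t, c k.succ t)) D 0 ∧
          D 1 = S.dL (q k.castSucc, q k.succ) ((δ k.castSucc : E), (δ k.succ : E)) :=
      ⟨_, hasMFDerivAt_iff_hasFDerivAt.1 h3,
        e _ (by rw [hc, hc]) _ _ (Prod.ext (hv k.castSucc) (hv k.succ))⟩
    exact hD.hasDerivAt.congr_deriv hD1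
  have hderiv : deriv (fun t ↦ S.action (fun k ↦ c k t)) 0 = _ :=
    (HasDerivAt.fun_sum (u := Finset.univ) (fun k _ ↦ hterm k)).deriv
  refine (congrArg (· + S.forceSum q δ) hderiv).trans ?_
  refine sum_add_sum_eq_zero_of_shift
    (T := fun k ↦ S.totalForm (q k.castSucc, q k.succ) ((δ k.castSucc : E), (0 : E)))
    (T' := fun k ↦ S.totalForm (q k.castSucc, q k.succ) ((0 : E), (δ k.succ : E)))
    (fun k ↦ S.totalForm_split _ _ _) ?_ ?_ (fun k ↦ h k _)
  · have e : (((δ 0 : E), (0 : E)) : E × E) = 0 := Prod.ext h0 rfl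
    exact (congrArg (S.totalForm _) e).trans (map_zero _)
  · have e : (((0 : E), (δ (Fin.last (M + 1)) : E)) : E × E) = 0 := Prod.ext rfl hN
    exact (congrArg (S.totalForm _) e).trans (map_zero _)

/-! ### Splitting the Euler-Lagrange covector into horizontal and vertical parts -/

namespace IsPrincipalBundle

variable (hπ : IsPrincipalBundle E Q EG G EB)
include hπ

/-- Horizontal lifts exist: subtract from any lift of `u` its vertical part. -/
theorem horLift_spec (𝔄 : PrincipalConnection E Q EG G) (q : Q)
    (u : TangentSpace 𝓘(ℝ, EB) (proj G q)) :
    𝔄.form q (horLift 𝔄 q u) = 0 ∧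
      mfderiv 𝓘(ℝ, E) 𝓘(ℝ, EB) (proj G) q (horLift 𝔄 q u) = u := by
  refine Classical.epsilon_spec (p := fun δ : TangentSpace 𝓘(ℝ, E) q ↦
    𝔄.form q δ = 0 ∧ mfderiv 𝓘(ℝ, E) 𝓘(ℝ, EB) (proj G) q δ = u) ?_
  obtain ⟨δ, hδ⟩ := hπ.mfderiv_proj_surjective q u
  refine ⟨δ - infGen E (𝔄.form q δ) q, ?_, ?_⟩
  · rw [map_sub, 𝔄.form_infGen, sub_self]
  · rw [map_sub, hπ.mfderiv_proj_infGen, hδ]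
    exact sub_zero (u : EB)

/-- Every tangent vector is the sum of a horizontal lift and an infinitesimal generator. -/
theorem exists_eq_horLift_add_infGen (𝔄 : PrincipalConnection E Q EG G) (q : Q)
    (δ : TangentSpace 𝓘(ℝ, E) q) :
    ∃ (u : TangentSpace 𝓘(ℝ, EB) (proj G q)) (ξ : Lie EG G),
      δ = horLift 𝔄 q u + infGen E ξ q := by
  let u : TangentSpace 𝓘(ℝ, EB) (proj G q) := mfderiv 𝓘(ℝ, E) 𝓘(ℝ, EB) (proj G) q δ
  obtain ⟨ξ, hξ⟩ := hπ.exists_infGen_eq (δ := δ - horLift 𝔄 q u) (by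
    rw [map_sub, (hπ.horLift_spec 𝔄 q u).2]
    exact sub_self (u : EB))
  exact ⟨u, ξ, by rw [hξ]; abel⟩

theorem totalForm_left (C : AffineDiscreteConnection E Q EG G) (S : FDMS E Q) (q₀ q₁ : Q)
    (δ : TangentSpace 𝓘(ℝ, E) q₀) :
    S.totalForm (q₀, q₁) ((δ : E), (0 : E)) =
      part1 (dLCheck EB C S (PhiTilde C (q₀, q₁))) δ
      + part2 (dLCheck EB C S (PhiTilde C (q₀, q₁))) (D1A C q₀ q₁ δ)
      + (part1 (fCheck EB C S (PhiTilde C (q₀, q₁))) δ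
      + part2 (fCheck EB C S (PhiTilde C (q₀, q₁))) (D1A C q₀ q₁ δ)) := by
  rw [← hπ.apply_mfderiv_PhiTilde_left, ← hπ.apply_mfderiv_PhiTilde_left]
  exact congrArg₂ (· + ·) (hπ.dLCheck_mfderiv_PhiTilde C S _ _).symm
    (hπ.fCheck_mfderiv_PhiTilde C S _ _).symm

theorem totalForm_right (C : AffineDiscreteConnection E Q EG G) (S : FDMS E Q) (q₀ q₁ : Q)
    (δ : TangentSpace 𝓘(ℝ, E) q₁) :
    S.totalForm (q₀, q₁) ((0 : E), (δ : E)) =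
      part2 (dLCheck EB C S (PhiTilde C (q₀, q₁))) (D2A C q₀ q₁ δ)
      + part3 (dLCheck EB C S (PhiTilde C (q₀, q₁)))
        (mfderiv 𝓘(ℝ, E) 𝓘(ℝ, EB) (proj G) q₁ δ)
      + (part2 (fCheck EB C S (PhiTilde C (q₀, q₁))) (D2A C q₀ q₁ δ)
      + part3 (fCheck EB C S (PhiTilde C (q₀, q₁)))
        (mfderiv 𝓘(ℝ, E) 𝓘(ℝ, EB) (proj G) q₁ δ)) := by
  rw [← hπ.apply_mfderiv_PhiTilde_right, ← hπ.apply_mfderiv_PhiTilde_right]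
  exact congrArg₂ (· + ·) (hπ.dLCheck_mfderiv_PhiTilde C S _ _).symm
    (hπ.fCheck_mfderiv_PhiTilde C S _ _).symm

/-- `φ` is the horizontal part of the Euler-Lagrange covector. -/
theorem eulerLagrange_horLift (C : AffineDiscreteConnection E Q EG G)
    (𝔄 : PrincipalConnection E Q EG G) (S : FDMS E Q) (q₀ q₁ q₂ : Q)
    (u : TangentSpace 𝓘(ℝ, EB) (proj G q₁)) :
    S.eulerLagrange q₀ q₁ q₂ (horLift 𝔄 q₁ u) = phi C 𝔄 S q₀ q₁ q₂ u := by
  rw [FDMS.eulerLagrange, hπ.totalForm_left C, hπ.totalForm_right C, (hπ.horLift_spec 𝔄 q₁ u).2]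
  simp only [phi]
  ring

/-- Invariance of `L` under the flow of the diagonal action, in the direction `ξ`. -/
theorem dL_infGen {S : FDMS E Q} (hS : IsSymmetryGroup G S) (q₀ q₁ : Q)
    (ξ : Lie EG G) :
    S.dL (q₀, q₁) ((infGen E ξ q₀ : E), (infGen E ξ q₁ : E)) = 0 := by
  have h0 := hπ.mdifferentiableAt_smul_const 1 q₀
  have h1 := hπ.mdifferentiableAt_smul_const 1 q₁
  have h := mfderiv_comp_apply_of_eq (f := fun g : G ↦ (g • q₀, g • q₁)) (g := S.L)
    (x := (1 : G)) (y := (q₀, q₁)) (S.mdifferentiableAt_L _) (h0.prodMk h1) (by simp) ξ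
  have e : S.L ∘ (fun g : G ↦ (g • q₀, g • q₁)) = fun _ ↦ S.L (q₀, q₁) :=
    funext fun g ↦ hS.invariant_L g (q₀, q₁)
  rw [e, mfderiv_prodMk h0 h1, mfderiv_const] at h
  exact h.symm

/-- `ψ` is the vertical part of the Euler-Lagrange covector. By invariance of `L`, a vertical
variation of the first point of `(q₁, q₂)` may be traded for one of the second point, which
changes only the `G`-component of `Φ̃`. -/
theorem eulerLagrange_infGen (C : AffineDiscreteConnection E Q EG G) {S : FDMS E Q}
    (hS : IsSymmetryGroup G S) (q₀ q₁ q₂ : Q) (ξ : Lie EG G) :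
    S.eulerLagrange q₀ q₁ q₂ (infGen E ξ q₁) = psi EB C S q₀ q₁ q₂ ξ := by
  have key : part1 (dLCheck EB C S (PhiTilde C (q₁, q₂))) (infGen E ξ q₁)
      + part2 (dLCheck EB C S (PhiTilde C (q₁, q₂))) (D1A C q₁ q₂ (infGen E ξ q₁))
      + part2 (dLCheck EB C S (PhiTilde C (q₁, q₂))) (rightTranslate (C.A (q₁, q₂)) ξ) = 0 := by
    have h0 := hπ.apply_mfderiv_PhiTilde_left C q₁ q₂
      (dLCheck EB C S (PhiTilde C (q₁, q₂))) (infGen E ξ q₁)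
    have h1 := hπ.apply_mfderiv_PhiTilde_right C q₁ q₂
      (dLCheck EB C S (PhiTilde C (q₁, q₂))) (infGen E ξ q₂)
    have z : part3 (dLCheck EB C S (PhiTilde C (q₁, q₂)))
        (mfderiv 𝓘(ℝ, E) 𝓘(ℝ, EB) (proj G) q₂ (infGen E ξ q₂)) = 0 := by
      rw [hπ.mfderiv_proj_infGen]; exact map_zero _
    rw [z, add_zero, hπ.D2A_infGen] at h1
    rw [← h0, ← h1]
    refine (congrArg₂ (· + ·) (hπ.dLCheck_mfderiv_PhiTilde C S _ _)
      (hπ.dLCheck_mfderiv_PhiTilde C S _ _)).trans (Eq.trans ?_ (hπ.dL_infGen hS q₁ q₂ ξ))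
    refine (map_add (S.dL (q₁, q₂))
      ((infGen E ξ q₁ : E), (0 : E)) ((0 : E), (infGen E ξ q₂ : E))).symm.trans (congrArg _ ?_)
    exact Prod.ext (add_zero (infGen E ξ q₁ : E)) (zero_add (infGen E ξ q₂ : E))
  have z (α : TangentSpace (𝓘(ℝ, E).prod (𝓘(ℝ, EG).prod 𝓘(ℝ, EB))) (PhiTilde C (q₀, q₁)) →L[ℝ] ℝ) :
      part3 α (mfderiv 𝓘(ℝ, E) 𝓘(ℝ, EB) (proj G) q₁ (infGen E ξ q₁)) = 0 := by
    rw [hπ.mfderiv_proj_infGen]; exact map_zero _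
  rw [FDMS.eulerLagrange, hπ.totalForm_left C, hπ.totalForm_right C, z, z]
  simp only [psi]
  rw [hπ.D2A_infGen]
  linarith

/-! ### Equivariance under the diagonal action -/

theorem mfderiv_const_smul_prod (g : G) (p : Q × Q) (a b : E) :
    mfderiv (𝓘(ℝ, E).prod 𝓘(ℝ, E)) (𝓘(ℝ, E).prod 𝓘(ℝ, E)) (fun x : Q × Q ↦ g • x) p (a, b) =
      ((mfderiv 𝓘(ℝ, E) 𝓘(ℝ, E) (fun x : Q ↦ g • x) p.1 a : E),
        (mfderiv 𝓘(ℝ, E) 𝓘(ℝ, E) (fun x : Q ↦ g • x) p.2 b : E)) := by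
  have h := mfderiv_prodMap (p := p) (hπ.mdifferentiableAt_const_smul g p.1)
    (hπ.mdifferentiableAt_const_smul g p.2)
  have e : (fun x : Q × Q ↦ g • x) = Prod.map (fun x : Q ↦ g • x) (fun x : Q ↦ g • x) := rfl
  rw [e, h]
  rfl

theorem totalForm_smul {S : FDMS E Q} (hS : IsSymmetryGroup G S) (g : G) (p : Q × Q)
    (δ : TangentSpace (𝓘(ℝ, E).prod 𝓘(ℝ, E)) p) :
    S.totalForm (g • p)
      (mfderiv (𝓘(ℝ, E).prod 𝓘(ℝ, E)) (𝓘(ℝ, E).prod 𝓘(ℝ, E)) (fun x : Q × Q ↦ g • x) p δ) =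
    S.totalForm p δ := by
  have hg : MDifferentiableAt (𝓘(ℝ, E).prod 𝓘(ℝ, E)) (𝓘(ℝ, E).prod 𝓘(ℝ, E))
      (fun x : Q × Q ↦ g • x) p :=
    (hπ.mdifferentiableAt_const_smul g p.1).prodMap' (hπ.mdifferentiableAt_const_smul g p.2)
  have h := mfderiv_comp_apply p (g := S.L) (S.mdifferentiableAt_L (g • p)) hg δ
  have e : S.L ∘ (fun x : Q × Q ↦ g • x) = S.L := funext (hS.invariant_L g)
  rw [e] at h
  have hL : S.dL (g • p)
      (mfderiv (𝓘(ℝ, E).prod 𝓘(ℝ, E)) (𝓘(ℝ, E).prod 𝓘(ℝ, E)) (fun x : Q × Q ↦ g • x) p δ) =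
    S.dL p δ := h.symm
  exact congrArg₂ (· + ·) hL (hS.invariant_f g p δ)

/-- The Euler-Lagrange covector is equivariant for the diagonal action. -/
theorem eulerLagrange_smul {S : FDMS E Q} (hS : IsSymmetryGroup G S) (g : G) (q₀ q₁ q₂ : Q)
    (δ : TangentSpace 𝓘(ℝ, E) q₁) :
    S.eulerLagrange (g • q₀) (g • q₁) (g • q₂)
      (mfderiv 𝓘(ℝ, E) 𝓘(ℝ, E) (fun x : Q ↦ g • x) q₁ δ) = S.eulerLagrange q₀ q₁ q₂ δ := by
  have e0 := hπ.mfderiv_const_smul_prod g (q₀, q₁) 0 δ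
  have e1 := hπ.mfderiv_const_smul_prod g (q₁, q₂) δ 0
  have z (q : Q) : (mfderiv 𝓘(ℝ, E) 𝓘(ℝ, E) (fun x : Q ↦ g • x) q (0 : E) : E) = 0 := map_zero _
  rw [z] at e0 e1
  exact congrArg₂ (· + ·)
    ((congrArg (S.totalForm (g • (q₀, q₁))) e0.symm).trans (hπ.totalForm_smul hS g (q₀, q₁) _))
    ((congrArg (S.totalForm (g • (q₁, q₂))) e1.symm).trans (hπ.totalForm_smul hS g (q₁, q₂) _))

/-- The reduced equations at a triple imply the Euler-Lagrange equation there. -/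
theorem eulerLagrange_eq_zero (C : AffineDiscreteConnection E Q EG G)
    (𝔄 : PrincipalConnection E Q EG G) {S : FDMS E Q} (hS : IsSymmetryGroup G S) {q₀ q₁ q₂ : Q}
    (hφ : ∀ u : TangentSpace 𝓘(ℝ, EB) (proj G q₁), phi C 𝔄 S q₀ q₁ q₂ u = 0)
    (hψ : ∀ ξ : Lie EG G, psi EB C S q₀ q₁ q₂ ξ = 0) (δ : TangentSpace 𝓘(ℝ, E) q₁) :
    S.eulerLagrange q₀ q₁ q₂ δ = 0 := by
  obtain ⟨u, ξ, rfl⟩ := hπ.exists_eq_horLift_add_infGen 𝔄 q₁ δ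
  rw [S.eulerLagrange_add, hπ.eulerLagrange_horLift C, hπ.eulerLagrange_infGen C hS, hφ, hψ,
    add_zero]

/-! ### Fibres of `Υ` and lifting of discrete curves -/

/-- By freeness of the action, `Υ (q₀, q₁)` together with `q₀` determines `A (q₀, q₁)` and `π q₁`,
hence `q₁` by injectivity of `Φ̃`. -/
theorem eq_of_Upsilon_eq (C : AffineDiscreteConnection E Q EG G) {q₀ q₁ q₁' : Q}
    (h : Upsilon C q₀ q₁ = Upsilon C q₀ q₁') : q₁ = q₁' := by
  obtain ⟨g, hg, hw⟩ := exists_smul_eq_of_rho_eq (congrArg Prod.fst h)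
  obtain rfl := hπ.eq_one_of_smul_eq hg
  have hA : C.A (q₀, q₁) = C.A (q₀, q₁') := by simpa using hw
  have hp : proj G q₁ = proj G q₁' := congrArg Prod.snd h
  have hΦ : PhiTilde C (q₀, q₁) = PhiTilde C (q₀, q₁') :=
    Prod.ext rfl (Prod.ext hA hp)
  exact congrArg Prod.snd ((Function.LeftInverse.injective (PsiTilde_PhiTilde C)) hΦ)

/-- Pairs with the same image under `Υ` lie in one orbit of the diagonal action. -/
theorem exists_smul_eq_of_Upsilon_eq (C : AffineDiscreteConnection E Q EG G)
    {q₀ q₁ q₀' q₁' : Q} (h : Upsilon C q₀ q₁ = Upsilon C q₀' q₁') :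
    ∃ g : G, g • q₀ = q₀' ∧ g • q₁ = q₁' := by
  obtain ⟨g, rfl, -⟩ := exists_smul_eq_of_rho_eq (congrArg Prod.fst h)
  refine ⟨g, rfl, hπ.eq_of_Upsilon_eq C (q₀ := g • q₀) ?_⟩
  rw [← h]
  refine Prod.ext ?_ (proj_smul g q₁)
  refine (Quotient.sound (s := conjSetoid Q G) ⟨g, ?_⟩).symm
  rw [C.A_smul]

end IsPrincipalBundle

/-- Write `v = ρ (q, w)` with the given `q`; then `q'` is the second component of
`Ψ̃ (q, w, τ)`. -/
theorem exists_Upsilon_eq (C : AffineDiscreteConnection E Q EG G) {q : Q} {v : ConjBundle Q G}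
    (h : proj G q = conjProj v) (τ : Base Q G) : ∃ q' : Q, Upsilon C q q' = (v, τ) := by
  obtain ⟨⟨r, w⟩, rfl⟩ := Quotient.exists_rep v
  obtain ⟨g, rfl⟩ := exists_smul_eq_of_proj_eq (G := G) (q := r) (q' := q) h.symm
  have hΦ := PhiTilde_PsiTilde C (g • r, g * w * g⁻¹, τ)
  refine ⟨(PsiTilde C (g • r, g * w * g⁻¹, τ)).2, ?_⟩
  refine Prod.ext ?_ (congrArg (fun x ↦ x.2.2) hΦ)
  have hA : C.A (g • r, (PsiTilde C (g • r, g * w * g⁻¹, τ)).2) = g * w * g⁻¹ :=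
    congrArg (fun x ↦ x.2.1) hΦ
  rw [Upsilon, hA]
  exact (Quotient.sound (s := conjSetoid Q G) ⟨g, rfl⟩ : rho r w = _).symm

/-- Existence of the lifted curve: lift one step at a time. -/
theorem exists_lift (C : AffineDiscreteConnection E Q EG G) {N : ℕ} (hN : 0 < N)
    (v : Fin N → ConjBundle Q G) (τ : Fin N → Base Q G)
    (hmatch : ∀ (k : ℕ) (hk : k + 1 < N), τ ⟨k, by omega⟩ = conjProj (v ⟨k + 1, hk⟩))
    (q₀ : Q) (hq₀ : proj G q₀ = conjProj (v ⟨0, hN⟩)) :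
    ∃ q : Fin (N + 1) → Q, q 0 = q₀ ∧
      ∀ k : Fin N, Upsilon C (q k.castSucc) (q k.succ) = (v k, τ k) := by
  classical
  -- `hproj` shows by induction.
  let next (k : ℕ) (x : Q) : Q :=
    if h : ∃ hk : k < N, ∃ y, Upsilon C x y = (v ⟨k, hk⟩, τ ⟨k, hk⟩) then h.2.choose else x
  let r (k : ℕ) : Q := Nat.rec q₀ next k
  have hstep (k : ℕ) (hk : k < N) (h : proj G (r k) = conjProj (v ⟨k, hk⟩)) :
      Upsilon C (r k) (r (k + 1)) = (v ⟨k, hk⟩, τ ⟨k, hk⟩) := by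
    have hex : ∃ hk : k < N, ∃ y, Upsilon C (r k) y = (v ⟨k, hk⟩, τ ⟨k, hk⟩) :=
      ⟨hk, exists_Upsilon_eq C h _⟩
    have hr : r (k + 1) = hex.2.choose := dif_pos hex
    rw [hr]
    exact hex.2.choose_spec
  have hproj (k : ℕ) (hk : k < N) : proj G (r k) = conjProj (v ⟨k, hk⟩) := by
    induction k with
    | zero => exact hq₀
    | succ k ih =>
      rw [← hmatch k hk]
      exact congrArg Prod.snd (hstep k (by omega) (ih (by omega)))
  exact ⟨fun k ↦ r k, rfl, fun k ↦ hstep k k.2 (hproj k k.2)⟩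

theorem IsPrincipalBundle.lift_unique (hπ : IsPrincipalBundle E Q EG G EB)
    (C : AffineDiscreteConnection E Q EG G) {N : ℕ} {q q' : Fin (N + 1) → Q} (h0 : q 0 = q' 0)
    (h : ∀ k : Fin N,
      Upsilon C (q k.castSucc) (q k.succ) = Upsilon C (q' k.castSucc) (q' k.succ)) : q = q' := by
  funext k
  induction k using Fin.induction with
  | zero => exact h0
  | succ k ih =>
    have hk := h k
    rw [ih] at hk
    exact hπ.eq_of_Upsilon_eq C hk

end FDMech

theorem mainTheorem2
    {E : Type*} [NormedAddCommGroup E] [NormedSpace ℝ E] [FiniteDimensional ℝ E]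
    {Q : Type*} [TopologicalSpace Q] [ChartedSpace E Q] [IsManifold 𝓘(ℝ, E) ∞ Q]
    {EG : Type*} [NormedAddCommGroup EG] [NormedSpace ℝ EG] [FiniteDimensional ℝ EG]
    {G : Type*} [TopologicalSpace G] [ChartedSpace EG G] [Group G] [LieGroup 𝓘(ℝ, EG) ∞ G]
    [MulAction G Q]
    {EB : Type*} [NormedAddCommGroup EB] [NormedSpace ℝ EB] [FiniteDimensional ℝ EB]
    [ChartedSpace EB (FDMech.Base Q G)] [IsManifold 𝓘(ℝ, EB) ∞ (FDMech.Base Q G)]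
    (hπ : FDMech.IsPrincipalBundle E Q EG G EB)
    (C : FDMech.AffineDiscreteConnection E Q EG G)
    (𝔄 : FDMech.PrincipalConnection E Q EG G)
    (S : FDMech.FDMS E Q) (hS : FDMech.IsSymmetryGroup G S)
    {N : ℕ} (hN : 0 < N)
    (v : Fin N → FDMech.ConjBundle Q G) (τ : Fin N → FDMech.Base Q G)
    (hmatch : ∀ (k : ℕ) (hk : k + 1 < N),
      τ ⟨k, by omega⟩ = FDMech.conjProj (v ⟨k + 1, hk⟩))
    (q₀ : Q) (hq₀ : FDMech.proj G q₀ = FDMech.conjProj (v ⟨0, hN⟩)) :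
    (∃! q : Fin (N + 1) → Q, q 0 = q₀ ∧
      ∀ k : Fin N, FDMech.Upsilon C (q k.castSucc) (q k.succ) = (v k, τ k)) ∧
    (FDMech.ReducedEquations EB C 𝔄 S v τ →
      ∀ q : Fin (N + 1) → Q, q 0 = q₀ →
        (∀ k : Fin N, FDMech.Upsilon C (q k.castSucc) (q k.succ) = (v k, τ k)) →
        S.IsTrajectory q) := by
  refine ⟨?_, ?_⟩
  · obtain ⟨q, hq0, hq⟩ := FDMech.exists_lift C hN v τ hmatch q₀ hq₀
    exact ⟨q, ⟨hq0, hq⟩, fun q' hq' ↦ hπ.lift_unique C (hq'.1.trans hq0.symm)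
      fun k ↦ (hq'.2 k).trans (hq k).symm⟩
  · intro hred q hq0 hq
    obtain ⟨M, rfl⟩ : ∃ M, N = M + 1 := ⟨N - 1, by omega⟩
    refine S.isTrajectory_of_eulerLagrange q fun k δ ↦ ?_
    obtain ⟨r₀, r₁, r₂, h₀, h₁, hφ, hψ⟩ := hred k (by omega)
    obtain ⟨g, hg₀, hg₁⟩ := hπ.exists_smul_eq_of_Upsilon_eq C ((hq k.castSucc).trans h₀.symm)
    obtain ⟨g', hg₁', hg₂⟩ := hπ.exists_smul_eq_of_Upsilon_eq C ((hq k.succ).trans h₁.symm)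
    -- The two pairs share their middle point, so by freeness one group element moves all three.
    obtain rfl : g = g' := hπ.smul_left_injective (hg₁.trans hg₁'.symm)
    subst hg₀ hg₁ hg₂
    rw [← hπ.eulerLagrange_smul hS g]
    exact hπ.eulerLagrange_eq_zero C 𝔄 hS hφ hψ _
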